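/- Let $\Gamma=(V,E)$ be a finite simple undirected graph. For $A\subseteq V$ let $\partial A$ be the set of edges joining $A$ to $V\setminus A$, and let $\delta A$ be the set of those vertices of $A$ that have a neighbour in $V\setminus A$ together with those vertices of $V\setminus A$ that have a neighbour in $A$. For $2\le n\le |V|$ put $$h_n(\Gamma)=\min\max_{1\le i\le n}\frac{|\partial A_i|}{|A_i|},\qquad \iota_n(\Gamma)=\min\max_{1\le i\le n}\frac{|\delta A_i|}{|A_i|},$$ where both minima are over all partitions $V=A_1\sqcup\cdots\sqcup A_n$ of $V$ into $n$ non-empty disjoint subsets. **Theorem.** Let $\Gamma=(V,E)$ be a finite connected simple graph that is vertex-transitive (its automorphism group acts transitively on $V$), and let $2\le n\le |V|-1$. Then $$h_n(\Gamma)\ \ge\ \frac{h_{n+1}(\Gamma)}{10n+h_{n+1}(\Gamma)}\qquad\text{and}\qquad \iota_n(\Gamma)\ \ge\ \frac{2\,\iota_{n+1}(\Gamma)}{20n+\iota_{n+1}(\Gamma)}.$$ In particular, $\iota_{n+1}(\Gamma)\le (11n+1)\,\iota_n(\Gamma)$. -/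

import Mathlib

namespace MultiwayIsoperimetry

/-- A graph is vertex-transitive if its automorphism group acts transitively on the vertices. -/
def IsVertexTransitive {V : Type*} (G : SimpleGraph V) : Prop :=
  ∀ u v : V, ∃ φ : G ≃g G, φ u = v

section Boundary

variable {V : Type*} [DecidableEq V] (G : SimpleGraph V) [DecidableRel G.Adj]

/-- The edge boundary `∂(A, B)` of disjoint vertex sets `A`, `B`: the edges joining `A` to `B`,
each recorded once, as the ordered pair `(u, v)` with `u ∈ A`, `v ∈ B`, `u` adjacent to `v`. -/
def edgeBoundary (A B : Finset V) : Finset (V × V) :=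
  G.interedges A B

/-- The symmetric vertex boundary `δ(A, B)` of disjoint vertex sets `A`, `B`: the vertices of `A`
with a neighbour in `B` together with the vertices of `B` with a neighbour in `A`. -/
def vertexBoundary (A B : Finset V) : Finset V :=
  {u ∈ A | ∃ v ∈ B, G.Adj u v} ∪ {v ∈ B | ∃ u ∈ A, G.Adj u v}

end Boundary

/-- `A 0, …, A (n - 1)` is a partition of `V` into `n` non-empty disjoint subsets. -/
structure IsPartition {V : Type*} {n : ℕ} (A : Fin n → Finset V) : Prop where
  nonempty : ∀ i, (A i).Nonempty
  disjoint : ∀ i j, i ≠ j → Disjoint (A i) (A j)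
  cover : ∀ v, ∃ i, v ∈ A i

noncomputable section Constants

variable {V : Type*} [Fintype V] [DecidableEq V] (G : SimpleGraph V) [DecidableRel G.Adj]

/-- `max_i |∂ A_i| / |A_i|`, where `∂ A = ∂(A, V \ A)`. -/
def edgeExpansion {n : ℕ} (A : Fin n → Finset V) : ℝ :=
  ⨆ i, ((edgeBoundary G (A i) (A i)ᶜ).card : ℝ) / ((A i).card : ℝ)

/-- `max_i |δ A_i| / |A_i|`, where `δ A = δ(A, V \ A)`. -/
def vertexExpansion {n : ℕ} (A : Fin n → Finset V) : ℝ :=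
  ⨆ i, ((vertexBoundary G (A i) (A i)ᶜ).card : ℝ) / ((A i).card : ℝ)

/-- The `n`-way isoperimetric constant `h_n`: the minimum of `max_i |∂ A_i| / |A_i|` over all
partitions of `V` into `n` non-empty subsets. -/
def h (n : ℕ) : ℝ :=
  sInf {r : ℝ | ∃ A : Fin n → Finset V, IsPartition A ∧ r = edgeExpansion G A}

/-- The `n`-way symmetric vertex isoperimetric constant `ι_n`: the minimum of
`max_i |δ A_i| / |A_i|` over all partitions of `V` into `n` non-empty subsets. -/
def iota (n : ℕ) : ℝ :=
  sInf {r : ℝ | ∃ A : Fin n → Finset V, IsPartition A ∧ r = vertexExpansion G A}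

/-- For `1 ≤ n ≤ |V|` there is a partition of `V` into `n` non-empty subsets. -/
theorem exists_isPartition {n : ℕ} (hn : 1 ≤ n) (hV : n ≤ Fintype.card V) :
    ∃ A : Fin n → Finset V, IsPartition A := by
  have : Nonempty (Fin n) := ⟨⟨0, hn⟩⟩
  obtain ⟨e⟩ : Nonempty (Fin n ↪ V) :=
    Function.Embedding.nonempty_of_card_le (by simpa using hV)
  refine ⟨fun i => {v | Function.invFun e v = i}, ⟨fun i => ⟨e i, ?_⟩, fun i j hij => ?_,
    fun v => ⟨Function.invFun e v, by simp⟩⟩⟩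
  · simpa using Function.leftInverse_invFun e.injective i
  · rw [Finset.disjoint_left]
    intro v hi hj
    simp only [Finset.mem_filter, Finset.mem_univ, true_and] at hi hj
    exact hij (hi.symm.trans hj)

/-- The infimum defining `h_n` is a minimum. -/
theorem h_isLeast {n : ℕ} (hn : 1 ≤ n) (hV : n ≤ Fintype.card V) :
    IsLeast {r : ℝ | ∃ A : Fin n → Finset V, IsPartition A ∧ r = edgeExpansion G A} (h G n) := by
  have hfin : {r : ℝ | ∃ A : Fin n → Finset V, IsPartition A ∧ r = edgeExpansion G A}.Finite :=
    (Set.finite_range (fun A : Fin n → Finset V => edgeExpansion G A)).subset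
      (by rintro _ ⟨A, -, rfl⟩; exact ⟨A, rfl⟩)
  obtain ⟨A, hA⟩ := exists_isPartition (V := V) hn hV
  exact ⟨Set.Nonempty.csInf_mem ⟨_, A, hA, rfl⟩ hfin, fun r hr => csInf_le hfin.bddBelow hr⟩

/-- The infimum defining `ι_n` is a minimum. -/
theorem iota_isLeast {n : ℕ} (hn : 1 ≤ n) (hV : n ≤ Fintype.card V) :
    IsLeast {r : ℝ | ∃ A : Fin n → Finset V, IsPartition A ∧ r = vertexExpansion G A}
      (iota G n) := by
  have hfin : {r : ℝ | ∃ A : Fin n → Finset V, IsPartition A ∧ r = vertexExpansion G A}.Finite :=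
    (Set.finite_range (fun A : Fin n → Finset V => vertexExpansion G A)).subset
      (by rintro _ ⟨A, -, rfl⟩; exact ⟨A, rfl⟩)
  obtain ⟨A, hA⟩ := exists_isPartition (V := V) hn hV
  exact ⟨Set.Nonempty.csInf_mem ⟨_, A, hA, rfl⟩ hfin, fun r hr => csInf_le hfin.bddBelow hr⟩

end Constants

end MultiwayIsoperimetry

/-! Take an optimal partition into `n` parts, with all ratios at most `ε`, and let `A i` be a
largest part. The aim is to cut `A i` in two by a translate of a part. Automorphisms preserve
boundary sizes and boundaries are subadditive, so both pieces have small boundary; they only have to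
be large enough. Edge and vertex boundaries are treated together, as functionals with a constant `k`
equal to 1 or 2.

If `A i` fills 4/5 of the graph, averaging over the group gives a translate of the second largest
part lying mostly inside `A i` (`exists_split_of_large`). Otherwise, if some translate of the
partition has no part that almost contains `A i`, one of its parts cuts `A i` substantially
(`exists_split_of_cut`).

In the remaining case every translate of `A i` lies almost inside a single part. The partition is
then close to a group-invariant one (`exists_invariant_coloring`). If that one is trivial, `A i` was
large after all. If not, connectedness and transitivity make the edges between its blocks a regular
graph of positive degree, which forces a total boundary of nearly `k * |V|` (`mul_le_sum`) and
contradicts the bound on `ε`.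

Thus `ι_{n+1}` or `h_{n+1}` is at most `10 n ε / (1 - ε / k)`; solving for `ε` gives the main
inequalities. The linear bound follows from the second one when `ι_n` is small, and from crude
bounds on `ι_{n+1}` otherwise. -/

namespace MultiwayIsoperimetry

open Finset
open scoped Pointwise

/-! ### Averaging over a transitive group, and almost invariant partitions. -/

section Action

variable {V Γ ι : Type*} [Fintype V] [DecidableEq V] [Group Γ] [Fintype Γ] [MulAction Γ V]

theorem sum_card_filter_comm {α β : Type*} [Fintype α] [Fintype β] (P : α → β → Prop)
    [∀ a b, Decidable (P a b)] : ∑ a, #{b | P a b} = ∑ b, #{a | P a b} := by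
  simp only [card_filter]
  exact sum_comm

/-- The number of translates of `A` containing a given point does not depend on the point. -/
theorem card_translates_mem [MulAction.IsPretransitive Γ V] (A : Finset V) (v : V) :
    #{g : Γ | v ∈ g • A} * Fintype.card V = Fintype.card Γ * #A := by
  have key : ∀ w : V, #{g : Γ | w ∈ g • A} = #{g : Γ | v ∈ g • A} := by
    intro w
    obtain ⟨h, rfl⟩ := MulAction.exists_smul_eq Γ v w
    refine (card_equiv (Equiv.mulLeft h) fun g => ?_).symm
    simp [mul_smul]
  have h1 : ∑ w : V, #{g : Γ | w ∈ g • A} = ∑ g : Γ, #{w : V | w ∈ g • A} :=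
    sum_card_filter_comm _
  simp only [key, sum_const, card_univ, smul_eq_mul, filter_mem_eq_inter, univ_inter,
    card_smul_finset] at h1
  rw [mul_comm, h1]

/-- Some translate of `B` meets `A` at least as much as a random set of the size of `B` does. -/
theorem exists_card_mul_card_le [MulAction.IsPretransitive Γ V] (A B : Finset V) :
    ∃ g : Γ, #A * #B ≤ Fintype.card V * #(A ∩ g • B) := by
  by_contra! hlt
  have h1 : ∑ g : Γ, #(A ∩ g • B) = ∑ v ∈ A, #{g : Γ | v ∈ g • B} := by
    simp only [card_filter]
    rw [sum_comm]
    simp only [← card_filter, filter_mem_eq_inter]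
  have h2 : Fintype.card V * ∑ g : Γ, #(A ∩ g • B) = Fintype.card Γ * (#A * #B) := by
    rw [h1, mul_comm, sum_mul, sum_congr rfl fun v _ => card_translates_mem B v]
    simp only [sum_const, smul_eq_mul]
    ring
  have h3 : ∑ g : Γ, Fintype.card V * #(A ∩ g • B) < ∑ g : Γ, #A * #B :=
    sum_lt_sum_of_nonempty univ_nonempty fun g _ => hlt g
  rw [← mul_sum, h2] at h3
  simp at h3

/-- If each translate of `A` is almost contained in one part of a partition into parts no larger
than `A`, then the partition is close to an invariant one. -/
theorem exists_invariant_coloring [MulAction.IsPretransitive Γ V] [DecidableEq ι] (p : V → ι)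
    (A : Finset V) (hA : A.Nonempty) (δ : ℝ) (hδ : δ < 1 / 4)
    (hmax : ∀ j, #{v | p v = j} ≤ #A)
    (hp : ∀ g : Γ, ∃ j, (#{v ∈ g • A | p v ≠ j} : ℝ) ≤ δ * #A) :
    ∃ c : V → ι, (∀ (g : Γ) (v w : V), c v = c w → c (g • v) = c (g • w)) ∧
      (1 - δ) * (#{v | p v ≠ c v} : ℝ) ≤ δ * Fintype.card V := by
  classical
  choose J hJ using hp
  have ha : (0 : ℝ) < #A := by exact_mod_cast hA.card_pos
  obtain ⟨v₁, -⟩ := hA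
  have hV : (0 : ℝ) < Fintype.card V := by exact_mod_cast Fintype.card_pos_iff.2 ⟨v₁⟩
  have hδ0 : 0 ≤ δ := by
    by_contra! h
    have := hJ 1
    have h0 : (0 : ℝ) ≤ #{v ∈ (1 : Γ) • A | p v ≠ J 1} := by positivity
    nlinarith
  have hin : ∀ g, (1 - δ) * (#A : ℝ) ≤ #{v ∈ g • A | p v = J g} := by
    intro g
    have h := card_filter_add_card_filter_not (s := g • A) (fun v => p v = J g)
    rw [card_smul_finset] at h
    have h' : (#{v ∈ g • A | p v = J g} : ℝ) + #{v ∈ g • A | p v ≠ J g} = #A := by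
      exact_mod_cast h
    linarith [hJ g]
  -- Two translates concentrated in one part, of size at most `#A`, overlap in at least `(1 - 2δ)
  -- #A` points; in different parts they overlap in at most `2δ #A`. As `δ < 1/4` these ranges are
  -- disjoint, so `J g = J g'` depends only on the overlap, which left translation preserves.
  have hsame : ∀ g g', J g = J g' ↔ 2 * δ * #A < (#(g • A ∩ g' • A) : ℝ) := by
    intro g g'
    constructor
    · intro h
      have h1 := card_union_add_card_inter {v ∈ g • A | p v = J g} {v ∈ g' • A | p v = J g'}
      have h2 : #({v ∈ g • A | p v = J g} ∪ {v ∈ g' • A | p v = J g'}) ≤ #A := by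
        refine (card_le_card ?_).trans (hmax (J g))
        intro v
        simp only [mem_union, mem_filter, mem_univ, true_and]
        rintro (h' | h')
        · exact h'.2
        · rw [h'.2, h]
      have h3 : #({v ∈ g • A | p v = J g} ∩ {v ∈ g' • A | p v = J g'}) ≤ #(g • A ∩ g' • A) :=
        card_le_card (inter_subset_inter (filter_subset _ _) (filter_subset _ _))
      have h1' : ((#({v ∈ g • A | p v = J g} ∪ {v ∈ g' • A | p v = J g'}) : ℕ) : ℝ) +
        (#({v ∈ g • A | p v = J g} ∩ {v ∈ g' • A | p v = J g'}) : ℕ) =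
        (#{v ∈ g • A | p v = J g} : ℕ) + (#{v ∈ g' • A | p v = J g'} : ℕ) := by exact_mod_cast h1
      have h2' : ((#({v ∈ g • A | p v = J g} ∪ {v ∈ g' • A | p v = J g'}) : ℕ) : ℝ) ≤ #A := by
        exact_mod_cast h2
      have h3' : ((#({v ∈ g • A | p v = J g} ∩ {v ∈ g' • A | p v = J g'}) : ℕ) : ℝ) ≤
        #(g • A ∩ g' • A) := by exact_mod_cast h3
      nlinarith [hin g, hin g']
    · intro h
      by_contra hne
      have h1 : #(g • A ∩ g' • A) ≤ #{v ∈ g • A | p v ≠ J g} + #{v ∈ g' • A | p v ≠ J g'} := by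
        refine (card_le_card ?_).trans (card_union_le _ _)
        intro v
        simp only [mem_union, mem_filter, mem_inter]
        rintro ⟨h1, h2⟩
        by_cases h3 : p v = J g
        · exact Or.inr ⟨h2, fun h4 => hne (h3.symm.trans h4)⟩
        · exact Or.inl ⟨h1, h3⟩
      have h1' : (#(g • A ∩ g' • A) : ℝ) ≤
        #{v ∈ g • A | p v ≠ J g} + #{v ∈ g' • A | p v ≠ J g'} := by exact_mod_cast h1
      linarith [hJ g, hJ g']
  have htrans : ∀ h g g', J (h * g) = J (h * g') ↔ J g = J g' := by
    intro h g g'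
    rw [hsame, hsame, mul_smul, mul_smul, ← smul_finset_inter, card_smul_finset]
  -- Each vertex lies in `D` translates, and these vote for its colour through `J`. The colour `c v`
  -- will be the one with at least `(1 - δ) D` votes.
  let Q : ι → V → ℕ := fun j v => #{g : Γ | v ∈ g • A ∧ J g = j}
  obtain ⟨D, hD⟩ : ∃ D : ℕ, D = #{g : Γ | v₁ ∈ g • A} := ⟨_, rfl⟩
  have hDV : D * Fintype.card V = Fintype.card Γ * #A := hD ▸ card_translates_mem A v₁
  have hDv : ∀ v, #{g : Γ | v ∈ g • A} = D := by
    intro v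
    have := card_translates_mem (Γ := Γ) A v
    rw [← hDV] at this
    exact Nat.eq_of_mul_eq_mul_right (by exact_mod_cast hV) this
  have hDV' : (D : ℝ) * Fintype.card V = Fintype.card Γ * #A := by exact_mod_cast hDV
  have hD0 : (0 : ℝ) < D := by
    have : (0 : ℝ) < Fintype.card Γ := by exact_mod_cast Fintype.card_pos
    have : (0 : ℝ) < D * Fintype.card V := by rw [hDV']; positivity
    exact pos_of_mul_pos_left this hV.le
  have hQsmul : ∀ h g v, Q (J (h * g)) (h • v) = Q (J g) v := by
    intro h g v
    refine (card_equiv (Equiv.mulLeft h) fun g' => ?_).symm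
    simp [mul_smul, htrans]
  have hQle : ∀ j v, Q j v ≤ D := by
    intro j v
    rw [← hDv v]
    exact card_le_card (monotone_filter_right _ fun g _ hg => hg.1)
  have hQadd : ∀ i j v, i ≠ j → Q i v + Q j v ≤ D := by
    intro i j v hij
    rw [← hDv v, ← card_union_of_disjoint]
    · refine card_le_card ?_
      intro g
      simp only [mem_union, mem_filter, mem_univ, true_and]
      tauto
    · rw [disjoint_filter]
      rintro g - ⟨-, h⟩ ⟨-, h'⟩
      exact hij (h.symm.trans h')
  have hsum : (1 - δ) * (D * Fintype.card V) ≤ ∑ v, (Q (p v) v : ℝ) := by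
    have h1 : ∑ v, Q (p v) v = ∑ g, #{v ∈ g • A | p v = J g} := by
      simp only [Q]
      rw [sum_card_filter_comm fun v g => v ∈ g • A ∧ J g = p v]
      refine sum_congr rfl fun g _ => congrArg card ?_
      ext v
      simp [eq_comm]
    have h2 : ∑ v, (Q (p v) v : ℝ) = ∑ g, (#{v ∈ g • A | p v = J g} : ℝ) := by
      exact_mod_cast h1
    rw [h2, hDV']
    calc (1 - δ) * (Fintype.card Γ * #A : ℝ) = ∑ g : Γ, (1 - δ) * (#A : ℝ) := by
          simp; ring
      _ ≤ _ := sum_le_sum fun g _ => hin g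
  -- On average a vertex has `(1 - δ) D` votes for its own part, so some vertex attains this;
  -- `hQsmul` and transitivity then carry such a majority to every vertex.
  have hex : ∃ v₀, (1 - δ) * D ≤ (Q (p v₀) v₀ : ℝ) := by
    by_contra! hlt
    have : ∑ v, (Q (p v) v : ℝ) < ∑ v : V, (1 - δ) * (D : ℝ) :=
      sum_lt_sum_of_nonempty ⟨v₁, mem_univ _⟩ fun v _ => hlt v
    simp only [sum_const, card_univ, nsmul_eq_mul] at this
    linarith
  have hlarge : ∀ j v, (1 - δ) * D ≤ (Q j v : ℝ) → ∃ g, J g = j := by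
    intro j v h
    have hpos : 0 < Q j v := by
      have : (0 : ℝ) < Q j v := by nlinarith
      exact_mod_cast this
    obtain ⟨g, hg⟩ := card_pos.1 hpos
    exact ⟨g, (mem_filter.1 hg).2.2⟩
  have hc : ∀ v, ∃ j, (1 - δ) * D ≤ (Q j v : ℝ) := by
    intro v
    obtain ⟨v₀, hv₀⟩ := hex
    obtain ⟨g, hg⟩ := hlarge _ _ hv₀
    obtain ⟨h, rfl⟩ := MulAction.exists_smul_eq Γ v₀ v
    exact ⟨J (h * g), by rw [hQsmul, hg]; exact hv₀⟩
  choose c hc using hc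
  have huniq : ∀ j v, (1 - δ) * D ≤ (Q j v : ℝ) → c v = j := by
    intro j v h
    by_contra hne
    have h1 : (Q (c v) v : ℝ) + Q j v ≤ D := by exact_mod_cast hQadd _ _ v hne
    nlinarith [hc v]
  refine ⟨c, fun g v w hvw => ?_, ?_⟩
  · obtain ⟨g₀, hg₀⟩ := hlarge _ _ (hc v)
    rw [huniq (J (g * g₀)) (g • v) (by rw [hQsmul, hg₀]; exact hc v),
      huniq (J (g * g₀)) (g • w) (by rw [hQsmul, hg₀, hvw]; exact hc w)]
  -- A vertex with `p v ≠ c v` loses at least the `(1 - δ) D` votes cast for `c v`, while `hsum`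
  -- bounds the total loss by `δ D |V|`.
  · have h1 : ∀ v, (if p v ≠ c v then (1 - δ) * (D : ℝ) else 0) ≤ D - Q (p v) v := by
      intro v
      split_ifs with h
      · have h1 : (Q (p v) v : ℝ) + Q (c v) v ≤ D := by exact_mod_cast hQadd _ _ v h
        linarith [hc v]
      · have : (Q (p v) v : ℝ) ≤ D := by exact_mod_cast hQle _ _
        linarith
    have h2 := sum_le_sum fun v (_ : v ∈ univ) => h1 v
    rw [← sum_filter, sum_const, sum_sub_distrib, sum_const, card_univ, nsmul_eq_mul,
      nsmul_eq_mul] at h2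
    have h3 : D * ((1 - δ) * (#{v | p v ≠ c v} : ℝ)) ≤ D * (δ * Fintype.card V) := by
      linarith
    exact le_of_mul_le_mul_left h3 hD0

end Action

/-! ### Abstract boundary functionals, and partitions close to an invariant one. -/

/-- The properties shared by the size `b A` of the edge boundary of `A` (with `k = 1`) and the size
of its symmetric vertex boundary (with `k = 2`), for a group `Γ` acting on the graph `G`. -/
structure IsBoundarySize {V : Type*} [Fintype V] [DecidableEq V] (Γ : Type*) [Group Γ]
    [MulAction Γ V] (G : SimpleGraph V) (k : ℝ) (b : Finset V → ℝ) : Prop where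
  nonneg : ∀ A, 0 ≤ b A
  smul : ∀ (g : Γ) A, b (g • A) = b A
  compl : ∀ A, b Aᶜ = b A
  inter_le : ∀ A B, b (A ∩ B) ≤ b A + b B
  regular_le : ∀ (d : ℕ) (R : V → V → Prop) [DecidableRel R], 0 < d → (∀ u v, R u v → R v u) →
    (∀ u v, R u v → G.Adj u v) → (∀ v, #{w | R v w} = d) →
    ∀ A : Finset V, k * #{e : V × V | e.1 ∈ A ∧ e.2 ∉ A ∧ R e.1 e.2} ≤ d * b A

section Regular

variable {V Γ ι : Type*} [Fintype V] [DecidableEq V] [Group Γ] [MulAction Γ V]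
  {G : SimpleGraph V} {k : ℝ} {b : Finset V → ℝ}

theorem IsBoundarySize.sdiff_le (hb : IsBoundarySize Γ G k b) (A B : Finset V) :
    b (A \ B) ≤ b A + b B := by
  rw [sdiff_eq_inter_compl]
  exact (hb.inter_le _ _).trans_eq (by rw [hb.compl])

theorem IsBoundarySize.union_le (hb : IsBoundarySize Γ G k b) (A B : Finset V) :
    b (A ∪ B) ≤ b A + b B := by
  rw [← hb.compl, compl_union]
  exact (hb.inter_le _ _).trans_eq (by rw [hb.compl, hb.compl])

theorem IsBoundarySize.biUnion_le (hb : IsBoundarySize Γ G k b) {s : Finset ι} (hs : s.Nonempty)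
    [DecidableEq ι] (A : ι → Finset V) : b (s.biUnion A) ≤ ∑ i ∈ s, b (A i) := by
  induction hs using Finset.Nonempty.cons_induction with
  | singleton a => simp
  | cons a s ha hs ih =>
    rw [cons_eq_insert, biUnion_insert, sum_insert ha]
    exact (hb.union_le _ _).trans (by gcongr)

/-- In a connected graph the edges joining different blocks of a nontrivial invariant partition
form a regular graph of positive degree. -/
theorem exists_card_cross_neighbors {V Γ ι : Type*} [Fintype V] [Group Γ] [MulAction Γ V]
    {G : SimpleGraph V} [DecidableEq ι] [MulAction.IsPretransitive Γ V]
    (hG : G.Connected) [DecidableRel G.Adj]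
    (hadj : ∀ (g : Γ) u v, G.Adj (g • u) (g • v) ↔ G.Adj u v) (c : V → ι)
    (hc : ∀ (g : Γ) (v w : V), c v = c w → c (g • v) = c (g • w)) (hne : ∃ u v, c u ≠ c v) :
    ∃ d : ℕ, 0 < d ∧ ∀ v, #{w | G.Adj v w ∧ c v ≠ c w} = d := by
  have hc' : ∀ (g : Γ) (v w : V), c (g • v) = c (g • w) ↔ c v = c w := fun g v w =>
    ⟨fun h => by simpa using hc g⁻¹ _ _ h, hc g v w⟩
  have hex : ∃ u v, G.Adj u v ∧ c u ≠ c v := by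
    by_contra! h
    obtain ⟨u, v, huv⟩ := hne
    obtain ⟨q⟩ := hG.preconnected u v
    apply huv
    clear huv
    induction q with
    | nil => rfl
    | cons h' _ ih => exact (h _ _ h').trans ih
  obtain ⟨u, v, huv⟩ := hex
  refine ⟨#{w | G.Adj u w ∧ c u ≠ c w}, card_pos.2 ⟨v, by simpa using huv⟩, fun v => ?_⟩
  obtain ⟨g, rfl⟩ := MulAction.exists_smul_eq Γ u v
  refine (card_equiv (MulAction.toPerm g) fun w => ?_).symm
  simp [hadj, hc']

/-- If a partition `p` is close to a partition `c` across whose blocks every vertex has `d`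
neighbours, then the parts of `p` have a large total boundary. -/
theorem IsBoundarySize.mul_le_sum (hb : IsBoundarySize Γ G k b) (hk : 0 ≤ k) [DecidableRel G.Adj]
    [Fintype ι] [DecidableEq ι] (p c : V → ι) {d : ℕ} (hd : 0 < d)
    (hreg : ∀ v, #{w | G.Adj v w ∧ c v ≠ c w} = d) :
    k * (Fintype.card V - 2 * #{v | p v ≠ c v}) ≤ ∑ j, b {v | p v = j} := by
  let R : V → V → Prop := fun u v => G.Adj u v ∧ c u ≠ c v
  have hsymm : ∀ u v, R u v → R v u := fun u v h => ⟨h.1.symm, h.2.symm⟩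
  have hdeg : ∀ v, #{w | R v w} = d := hreg
  have hfib : ∀ s : Finset V, #{e : V × V | e.1 ∈ s ∧ R e.1 e.2} = #s * d := by
    intro s
    have : ∀ v ∈ s, #{w | R v w} = d := fun v _ => hdeg v
    rw [← smul_eq_mul, ← sum_const, ← sum_congr rfl this, ← card_sigma]
    refine card_nbij' (fun e => ⟨e.1, e.2⟩) (fun e => (e.1, e.2)) ?_ ?_ ?_ ?_ <;>
      simp +contextual [Set.MapsTo, Set.LeftInvOn]
  have hfib' : ∀ s : Finset V, #{e : V × V | e.2 ∈ s ∧ R e.1 e.2} = #s * d := by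
    intro s
    rw [← hfib s]
    refine card_equiv (Equiv.prodComm V V) fun e => ?_
    simp only [mem_filter, mem_univ, true_and, Equiv.prodComm_apply, Prod.fst_swap, Prod.snd_swap]
    exact and_congr_right fun _ => ⟨hsymm _ _, hsymm _ _⟩
  let E : ι → Finset (V × V) := fun j => {e | e.1 ∈ ({v | p v = j} : Finset V) ∧
    e.2 ∉ ({v | p v = j} : Finset V) ∧ R e.1 e.2}
  let B : Finset V := {v | p v ≠ c v}
  let F₁ : Finset (V × V) := {e | e.1 ∈ B ∧ R e.1 e.2}
  let F₂ : Finset (V × V) := {e | e.2 ∈ B ∧ R e.1 e.2}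
  -- An `R`-pair joins different `c`-blocks, so if it stays inside one part of `p`, then `p` and `c`
  -- disagree at one of its ends.
  have hcover : (univ : Finset (V × V)).filter (fun e => e.1 ∈ univ ∧ R e.1 e.2) ⊆
      univ.biUnion E ∪ (F₁ ∪ F₂) := by
    rintro ⟨u, v⟩ h
    have hR : R u v := by simpa using h
    simp only [E, F₁, F₂, B, mem_union, mem_biUnion, mem_filter, mem_univ, true_and, hR, and_true,
      exists_eq_left']
    by_contra! h'
    exact hR.2 (by rw [← h'.2.1, ← h'.2.2, h'.1])
  have hcard := (card_le_card hcover).trans ((card_union_le _ _).trans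
    (add_le_add card_biUnion_le (card_union_le _ _)))
  rw [hfib, hfib, hfib', card_univ] at hcard
  have hcard' : (Fintype.card V * d : ℝ) ≤ ∑ j, (#(E j) : ℝ) + (#B * d + #B * d) := by
    exact_mod_cast hcard
  have hsum := sum_le_sum fun j (_ : j ∈ univ) =>
    hb.regular_le d R hd hsymm (fun _ _ h => h.1) hdeg {v | p v = j}
  rw [← mul_sum, ← mul_sum] at hsum
  have hd' : (0 : ℝ) < d := by exact_mod_cast hd
  refine le_of_mul_le_mul_left ?_ hd'
  refine le_trans ?_ hsum
  rw [mul_left_comm]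
  refine mul_le_mul_of_nonneg_left ?_ hk
  linarith

end Regular

/-! ### Splitting one part of a partition. -/

section Split

variable {V : Type*} [DecidableEq V] {n : ℕ}

/-- The piece inside `Y` keeps the place of `A i`; the piece outside becomes the new part, with
index 0. -/
theorem IsPartition.split {A : Fin n → Finset V} (hA : IsPartition A) (i : Fin n) (Y : Finset V)
    (h₁ : (A i ∩ Y).Nonempty) (h₂ : (A i \ Y).Nonempty) :
    IsPartition (Fin.cons (A i \ Y) (Function.update A i (A i ∩ Y)) : Fin (n + 1) → Finset V) := by
  have hsub : ∀ j, Function.update A i (A i ∩ Y) j ⊆ A j := by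
    intro j
    by_cases h : j = i
    · subst h; simp
    · simp [h]
  have h0 : ∀ j, Disjoint (A i \ Y) (Function.update A i (A i ∩ Y) j) := by
    intro j
    by_cases h : j = i
    · subst h
      simpa using disjoint_of_subset_right inter_subset_right sdiff_disjoint
    · simpa [h] using disjoint_of_subset_left sdiff_subset (hA.disjoint i j (Ne.symm h))
  refine ⟨fun j => ?_, fun j l hjl => ?_, fun v => ?_⟩
  · refine Fin.cases (by simpa using h₂) (fun j => ?_) j
    by_cases h : j = i
    · subst h; simpa using h₁
    · simpa [h] using hA.nonempty j
  · revert hjl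
    refine Fin.cases ?_ (fun j => ?_) j <;> refine Fin.cases ?_ (fun l => ?_) l
    · simp
    · intro _; simpa using h0 l
    · intro _; simpa using (h0 j).symm
    · intro hjl
      simpa using disjoint_of_subset_left (hsub j) (disjoint_of_subset_right (hsub l)
        (hA.disjoint j l fun h => hjl (by rw [h])))
  · obtain ⟨j, hj⟩ := hA.cover v
    by_cases h : j = i
    · subst h
      by_cases hY : v ∈ Y
      · exact ⟨Fin.succ j, by simp [hj, hY]⟩
      · exact ⟨0, by simp [hj, hY]⟩
    · exact ⟨Fin.succ j, by simpa [h] using hj⟩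

theorem IsPartition.exists_index {V : Type*} {n : ℕ} {A : Fin n → Finset V} (hA : IsPartition A) :
    ∃ p : V → Fin n, ∀ v j, v ∈ A j ↔ p v = j := by
  choose p hp using hA.cover
  refine ⟨p, fun v j => ⟨fun h => ?_, fun h => h ▸ hp v⟩⟩
  by_contra hne
  exact disjoint_left.1 (hA.disjoint _ _ hne) (hp v) h

end Split

/-! ### Refining a partition into `n` parts to one into `n + 1` parts. -/

section Refinement

variable {V Γ : Type*} [Fintype V] [DecidableEq V] [Group Γ] [Finite Γ] [MulAction Γ V]
  [MulAction.IsPretransitive Γ V] {G : SimpleGraph V} {k : ℝ} {b : Finset V → ℝ}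

/-- A part that fills most of the graph can be split by a translate of the largest other part. -/
theorem IsBoundarySize.exists_split_of_large (hb : IsBoundarySize Γ G k b) {n : ℕ} (hn : 2 ≤ n)
    {A : Fin n → Finset V} (hA : IsPartition A) {ε C : ℝ}
    (hε : ∀ i, b (A i) ≤ ε * #(A i)) (hε0 : 0 ≤ ε) (hC : 10 * n * ε ≤ C) (i : Fin n)
    (hi : 4 / 5 * (Fintype.card V : ℝ) ≤ #(A i)) :
    ∃ Y, (A i ∩ Y).Nonempty ∧ (A i \ Y).Nonempty ∧ b (A i ∩ Y) ≤ C * #(A i ∩ Y) ∧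
      b (A i \ Y) ≤ C * #(A i \ Y) := by
  have := Fintype.ofFinite Γ
  have hne : (univ.erase i : Finset (Fin n)).Nonempty := by
    rw [← card_pos, card_erase_of_mem (mem_univ _), card_univ, Fintype.card_fin]
    omega
  obtain ⟨l, hl, hmax⟩ := exists_max_image (univ.erase i) (fun j => #(A j)) hne
  obtain ⟨g, hg⟩ := exists_card_mul_card_le (Γ := Γ) (A i) (A l)
  have hli : l ≠ i := ne_of_mem_erase hl
  have hx : (0 : ℝ) < #(A i) := by exact_mod_cast (hA.nonempty i).card_pos
  have hy : (0 : ℝ) < #(A l) := by exact_mod_cast (hA.nonempty l).card_pos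
  have hN : (0 : ℝ) < Fintype.card V := by
    obtain ⟨v, -⟩ := hA.nonempty i
    exact_mod_cast Fintype.card_pos_iff.2 ⟨v⟩
  have hxy : (#(A i) : ℝ) + #(A l) ≤ Fintype.card V := by
    rw [← Nat.cast_add, ← card_union_of_disjoint (hA.disjoint i l hli.symm)]
    exact_mod_cast card_le_univ _
  -- The bound `ε * #(A i)` would be too weak for the small piece `A i ∩ g • A l`. Passing to the
  -- complement, a union of `n - 1` parts no larger than `A l`, gives one proportional to `#(A l)`.
  have hbi : b (A i) ≤ (n - 1) * (ε * #(A l)) := by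
    have hcompl : (A i)ᶜ = (univ.erase i).biUnion A := by
      ext v
      simp only [mem_compl, mem_biUnion, mem_erase, mem_univ, and_true]
      constructor
      · intro h
        obtain ⟨j, hj⟩ := hA.cover v
        exact ⟨j, fun h' => h (h' ▸ hj), hj⟩
      · rintro ⟨j, hji, hj⟩ h
        exact disjoint_left.1 (hA.disjoint _ _ hji) hj h
    rw [← hb.compl, hcompl]
    refine (hb.biUnion_le hne A).trans ?_
    have : ∀ j ∈ univ.erase i, b (A j) ≤ ε * #(A l) := fun j hj =>
      (hε j).trans (mul_le_mul_of_nonneg_left (by exact_mod_cast hmax j hj) hε0)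
    refine (sum_le_sum this).trans_eq ?_
    rw [sum_const, card_erase_of_mem (mem_univ _), card_univ, Fintype.card_fin, nsmul_eq_mul,
      Nat.cast_sub (by omega), Nat.cast_one]
  have hg' : (#(A i) : ℝ) * #(A l) ≤ Fintype.card V * #(A i ∩ g • A l) := by exact_mod_cast hg
  have hz : 4 / 5 * (#(A l) : ℝ) ≤ #(A i ∩ g • A l) := by
    refine le_of_mul_le_mul_left ?_ hN
    nlinarith
  have hzy : (#(A i ∩ g • A l) : ℝ) ≤ #(A l) := by
    rw [← card_smul_finset g (A l)]
    exact_mod_cast card_le_card inter_subset_right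
  have hw : (#(A i \ g • A l) : ℝ) + #(A i ∩ g • A l) = #(A i) := by
    exact_mod_cast card_sdiff_add_card_inter _ _
  have hw' : 3 / 4 * (#(A i) : ℝ) ≤ #(A i \ g • A l) := by linarith
  have hn' : (2 : ℝ) ≤ n := by exact_mod_cast hn
  have hεn : 2 * ε ≤ n * ε := mul_le_mul_of_nonneg_right hn' hε0
  have hbl : b (g • A l) ≤ ε * #(A l) := by rw [hb.smul]; exact hε l
  have hC0 : 0 ≤ C := le_trans (by positivity) hC
  refine ⟨g • A l, ?_, ?_, (hb.inter_le _ _).trans ?_, (hb.sdiff_le _ _).trans ?_⟩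
  · rw [← card_pos]
    exact_mod_cast (by linarith : (0 : ℝ) < #(A i ∩ g • A l))
  · rw [← card_pos]
    exact_mod_cast (by linarith : (0 : ℝ) < #(A i \ g • A l))
  · have h1 : C * (4 / 5 * #(A l)) ≤ C * #(A i ∩ g • A l) := mul_le_mul_of_nonneg_left hz hC0
    have h2 : 10 * n * ε * #(A l) ≤ C * #(A l) := mul_le_mul_of_nonneg_right hC hy.le
    have h3 : 0 ≤ n * ε * #(A l) := by positivity
    linarith
  · have h1 : C * (3 / 4 * #(A i)) ≤ C * #(A i \ g • A l) := mul_le_mul_of_nonneg_left hw' hC0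
    have h2 : 20 * ε * #(A i) ≤ C * #(A i) := mul_le_mul_of_nonneg_right (by linarith) hx.le
    have h3 : ε * #(A l) ≤ ε * #(A i) := mul_le_mul_of_nonneg_left (by linarith) hε0
    have h4 : 0 ≤ ε * #(A i) := by positivity
    linarith [hε i]

/-- If a largest part is cut substantially by every part of some translate of the partition, then
one of these parts splits it. -/
theorem IsBoundarySize.exists_split_of_cut {V Γ : Type*} [Fintype V] [DecidableEq V] [Group Γ]
    [MulAction Γ V] {G : SimpleGraph V} {k : ℝ} {b : Finset V → ℝ} (hb : IsBoundarySize Γ G k b) {n : ℕ}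
    {A : Fin n → Finset V} (hA : IsPartition A) {ε C δ : ℝ}
    (hε : ∀ i, b (A i) ≤ ε * #(A i)) (hε0 : 0 ≤ ε) (hδ : 0 < δ) (hδn : n * δ ≤ 1)
    (hC : 2 * ε ≤ C * δ) (i : Fin n) (hi : ∀ j, #(A j) ≤ #(A i)) (g : Γ)
    (hg : ∀ j, δ * #(A i) < #(A i \ g • A j)) :
    ∃ Y, (A i ∩ Y).Nonempty ∧ (A i \ Y).Nonempty ∧ b (A i ∩ Y) ≤ C * #(A i ∩ Y) ∧
      b (A i \ Y) ≤ C * #(A i \ Y) := by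
  have hx : (0 : ℝ) < #(A i) := by exact_mod_cast (hA.nonempty i).card_pos
  have hsub : A i ⊆ univ.biUnion fun j => A i ∩ g • A j := by
    intro v hv
    obtain ⟨j, hj⟩ := hA.cover (g⁻¹ • v)
    simp only [mem_biUnion, mem_univ, true_and]
    exact ⟨j, mem_inter.2 ⟨hv, inv_smul_mem_iff.1 hj⟩⟩
  have hsum : (#(A i) : ℝ) ≤ ∑ j, (#(A i ∩ g • A j) : ℝ) := by
    exact_mod_cast (card_le_card hsub).trans card_biUnion_le
  -- Pigeonhole over the `n` parts of the translate, using `n * δ ≤ 1`; `hg` makes the other piece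
  -- large for every `j`.
  obtain ⟨j, hj⟩ : ∃ j, δ * #(A i) ≤ (#(A i ∩ g • A j) : ℝ) := by
    by_contra! hlt
    have h1 := sum_lt_sum_of_nonempty (s := univ) ⟨i, mem_univ i⟩ fun j _ => hlt j
    rw [sum_const, card_univ, Fintype.card_fin, nsmul_eq_mul] at h1
    nlinarith
  have hC0 : 0 ≤ C := by
    by_contra! h
    nlinarith
  have hbj : b (g • A j) ≤ ε * #(A i) := by
    rw [hb.smul]
    exact (hε j).trans (mul_le_mul_of_nonneg_left (by exact_mod_cast hi j) hε0)
  have hbound : ∀ z : ℝ, δ * #(A i) ≤ z → b (A i) + b (g • A j) ≤ C * z := by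
    intro z hz
    have h1 : C * (δ * #(A i)) ≤ C * z := mul_le_mul_of_nonneg_left hz hC0
    have h2 : 2 * ε * #(A i) ≤ C * δ * #(A i) := mul_le_mul_of_nonneg_right hC hx.le
    linarith [hε i]
  have hpos : 0 < δ * #(A i) := mul_pos hδ hx
  refine ⟨g • A j, ?_, ?_, (hb.inter_le _ _).trans (hbound _ hj),
    (hb.sdiff_le _ _).trans (hbound _ (hg j).le)⟩
  · rw [← card_pos]
    exact_mod_cast hpos.trans_le hj
  · rw [← card_pos]
    exact_mod_cast hpos.trans (hg j)

/-- If a largest part of a partition is almost contained in one part of each translate of the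
partition, then either it fills most of the graph or the total boundary is large. -/
theorem IsBoundarySize.large_of_almost_invariant (hb : IsBoundarySize Γ G k b) (hk : 0 < k)
    (hG : G.Connected) (hadj : ∀ (g : Γ) u v, G.Adj (g • u) (g • v) ↔ G.Adj u v) {n : ℕ}
    {A : Fin n → Finset V} (hA : IsPartition A) {ε δ : ℝ}
    (hε : ∀ i, b (A i) ≤ ε * #(A i)) (hδ : 0 < δ) (hδ' : δ ≤ 1 / 10) (hεδ : ε ≤ k * (1 - 10 * δ))
    (i : Fin n) (hi : ∀ j, #(A j) ≤ #(A i))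
    (hg : ∀ g : Γ, ∃ j, (#(A i \ g • A j) : ℝ) ≤ δ * #(A i)) :
    4 / 5 * (Fintype.card V : ℝ) ≤ #(A i) := by
  classical
  have := Fintype.ofFinite Γ
  obtain ⟨p, hp⟩ := hA.exists_index
  have hpA : ∀ j, ({v | p v = j} : Finset V) = A j := by
    intro j
    ext v
    simp [hp]
  obtain ⟨c, hc, hpc⟩ := exists_invariant_coloring (Γ := Γ) p (A i) (hA.nonempty i) δ
    (by linarith) (fun j => by rw [hpA]; exact hi j) (fun g => by
      -- The hypothesis translates the partition, whereas the colouring lemma translates `A i`;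
      -- applying `g` to `A i \ g⁻¹ • A j` exchanges the two.
      obtain ⟨j, hj⟩ := hg g⁻¹
      refine ⟨j, le_of_eq_of_le ?_ hj⟩
      rw [← card_smul_finset g (A i \ g⁻¹ • A j), smul_finset_sdiff, smul_inv_smul]
      congr 2
      ext v
      simp [hp])
  obtain ⟨v₀, -⟩ := hA.nonempty i
  have hN : (0 : ℝ) < Fintype.card V := by exact_mod_cast Fintype.card_pos_iff.2 ⟨v₀⟩
  have hδN : 0 < δ * Fintype.card V := mul_pos hδ hN
  have hm : (0 : ℝ) ≤ #{v | p v ≠ c v} := by positivity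
  have hm' : 9 / 10 * (#{v | p v ≠ c v} : ℝ) ≤ δ * Fintype.card V := by nlinarith
  by_cases hne : ∃ u v, c u ≠ c v
  · exfalso
    obtain ⟨d, hd, hreg⟩ := exists_card_cross_neighbors hG hadj c hc hne
    have h1 := hb.mul_le_sum hk.le p c hd hreg
    simp only [hpA] at h1
    have h2 : ∑ j, b (A j) ≤ ε * Fintype.card V := by
      refine (sum_le_sum fun j _ => hε j).trans_eq ?_
      rw [← mul_sum, ← Nat.cast_sum]
      congr 2
      rw [← card_univ, card_eq_sum_card_fiberwise (f := p) (t := univ) (by simp)]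
      exact sum_congr rfl fun j _ => by rw [hpA]
    have h3 : ε * Fintype.card V ≤ k * (1 - 10 * δ) * Fintype.card V :=
      mul_le_mul_of_nonneg_right hεδ hN.le
    -- This forces at least `5δ|V|` disagreements between `p` and `c`, but `hm'` allows at most
    -- `(10/9)δ|V|`.
    have h4 : (Fintype.card V : ℝ) - 2 * #{v | p v ≠ c v} ≤ (1 - 10 * δ) * Fintype.card V := by
      refine le_of_mul_le_mul_left ?_ hk
      linarith
    linarith
  · push Not at hne
    -- With `c` constant, all but at most `|V|/9` vertices lie in the single part `A (c v₀)`.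
    have h1 := card_filter_add_card_filter_not (s := (univ : Finset V)) (fun v => p v = c v₀)
    rw [hpA] at h1
    have h2 : ({v | p v ≠ c v} : Finset V) = ({v | ¬ p v = c v₀} : Finset V) := by
      ext v
      simp [hne v v₀]
    have h3 : (#(A (c v₀)) : ℝ) + #{v | ¬ p v = c v₀} = Fintype.card V := by exact_mod_cast h1
    have h4 : (#(A (c v₀)) : ℝ) ≤ #(A i) := by exact_mod_cast hi _
    have h5 : δ * Fintype.card V ≤ 1 / 10 * Fintype.card V := mul_le_mul_of_nonneg_right hδ' hN.le
    rw [h2] at hm'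
    linarith

/-- A partition of a connected vertex-transitive graph into `n` parts with small boundary can be
refined to one into `n + 1` parts whose boundary is not much larger. -/
theorem IsBoundarySize.exists_refinement (hb : IsBoundarySize Γ G k b) (hk : 0 < k)
    (hG : G.Connected) (hadj : ∀ (g : Γ) u v, G.Adj (g • u) (g • v) ↔ G.Adj u v) {n : ℕ}
    (hn : 2 ≤ n) {A : Fin n → Finset V} (hA : IsPartition A) {ε : ℝ}
    (hε : ∀ i, b (A i) ≤ ε * #(A i)) (hεk : ε < k) :
    ∃ A' : Fin (n + 1) → Finset V, IsPartition A' ∧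
      ∀ i, b (A' i) ≤ 10 * n * ε / (1 - ε / k) * #(A' i) := by
  have hn' : (2 : ℝ) ≤ n := by exact_mod_cast hn
  obtain ⟨i, -, hi⟩ := exists_max_image univ (fun j => #(A j)) ⟨⟨0, by omega⟩, mem_univ _⟩
  replace hi : ∀ j, #(A j) ≤ #(A i) := fun j => hi j (mem_univ j)
  have hx : (0 : ℝ) < #(A i) := by exact_mod_cast (hA.nonempty i).card_pos
  have hε0 : 0 ≤ ε := nonneg_of_mul_nonneg_left ((hb.nonneg _).trans (hε i)) hx
  have hr : 0 < 1 - ε / k := by rw [sub_pos, div_lt_one hk]; exact hεk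
  have hr1 : 1 - ε / k ≤ 1 := by linarith [div_nonneg hε0 hk.le]
  set C := 10 * n * ε / (1 - ε / k) with hCdef
  have hC : 10 * n * ε ≤ C := le_div_self (by positivity) hr hr1
  have hCε : ε ≤ C := by nlinarith
  -- Chosen so that `C * δ = 2 * ε`, as cutting requires, while `n ≥ 2` gives `10 * δ ≤ 1 - ε / k`,
  -- as the almost invariant case requires.
  let δ := (1 - ε / k) / (5 * n)
  have hδ : 0 < δ := by positivity
  have hδeq : 5 * (n * δ) = 1 - ε / k := by
    simp only [δ]
    field_simp
  have hδn : 2 * δ ≤ n * δ := mul_le_mul_of_nonneg_right hn' hδ.le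
  have hCδ : 2 * ε ≤ C * δ := by
    apply le_of_eq
    simp only [hCdef, δ]
    rw [div_mul_div_comm, mul_comm (1 - ε / k) (5 * (n : ℝ)), mul_div_mul_right _ _ hr.ne']
    field_simp
    ring
  suffices h : ∃ Y, (A i ∩ Y).Nonempty ∧ (A i \ Y).Nonempty ∧ b (A i ∩ Y) ≤ C * #(A i ∩ Y) ∧
      b (A i \ Y) ≤ C * #(A i \ Y) by
    obtain ⟨Y, h₁, h₂, h₃, h₄⟩ := h
    refine ⟨_, hA.split i Y h₁ h₂, fun j => ?_⟩
    refine Fin.cases (by simpa using h₄) (fun j => ?_) j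
    by_cases hj : j = i
    · subst hj
      simpa using h₃
    · simpa [hj] using (hε j).trans (mul_le_mul_of_nonneg_right hCε (Nat.cast_nonneg _))
  by_cases hlarge : 4 / 5 * (Fintype.card V : ℝ) ≤ #(A i)
  · exact hb.exists_split_of_large hn hA hε hε0 hC i hlarge
  by_cases hcut : ∃ g : Γ, ∀ j, δ * #(A i) < #(A i \ g • A j)
  · obtain ⟨g, hg⟩ := hcut
    exact hb.exists_split_of_cut hA hε hε0 hδ (by linarith) hCδ i hi g hg
  · push Not at hcut
    refine absurd (hb.large_of_almost_invariant hk hG hadj hA hε hδ (by linarith) ?_ i hi hcut)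
      hlarge
    have : k * (1 - 10 * δ) - ε = k * ((1 - ε / k) - 10 * δ) := by
      field_simp
      ring
    have : 0 ≤ k * ((1 - ε / k) - 10 * δ) := mul_nonneg hk.le (by linarith)
    linarith

end Refinement

/-! ### Edge and vertex boundaries as boundary functionals. -/

section BoundarySize

variable {V Γ : Type*} [Fintype V] [DecidableEq V] [Group Γ] [MulAction Γ V] (G : SimpleGraph V)
  [DecidableRel G.Adj]

theorem edgeBoundary_compl_eq (A : Finset V) :
    edgeBoundary G A Aᶜ =
      ({e | e.1 ∈ A ∧ e.2 ∉ A ∧ G.Adj e.1 e.2} : Finset (V × V)) := by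
  ext ⟨u, v⟩
  simp [edgeBoundary, SimpleGraph.mem_interedges_iff]

theorem vertexBoundary_compl_eq (A : Finset V) :
    vertexBoundary G A Aᶜ = ({v | ∃ w, G.Adj v w ∧ ¬ (v ∈ A ↔ w ∈ A)} : Finset V) := by
  ext v
  simp only [vertexBoundary, mem_union, mem_filter, mem_compl, mem_univ, true_and]
  constructor
  · rintro (⟨h, w, hw, hvw⟩ | ⟨h, w, hw, hvw⟩)
    · exact ⟨w, hvw, fun h' => hw (h'.1 h)⟩
    · exact ⟨w, hvw.symm, fun h' => h (h'.2 hw)⟩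
  · rintro ⟨w, hvw, h⟩
    by_cases hv : v ∈ A
    · exact Or.inl ⟨hv, w, fun hw => h (by simp [hv, hw]), hvw⟩
    · exact Or.inr ⟨hv, w, by tauto, hvw.symm⟩

/-- Sending a crossing pair to either of its ends is at most `d`-to-one. The inner and outer ends
are disjoint sets, so adding the two bounds yields `k = 2` for the vertex boundary. -/
theorem card_crossing_le_mul_of_regular (R : V → V → Prop) [DecidableRel R] {d : ℕ}
    (hsymm : ∀ u v, R u v → R v u) (hdeg : ∀ v, #{w | R v w} = d) (A : Finset V) :
    #{e : V × V | e.1 ∈ A ∧ e.2 ∉ A ∧ R e.1 e.2} ≤ d * #{v ∈ A | ∃ w, w ∉ A ∧ R v w} ∧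
    #{e : V × V | e.1 ∈ A ∧ e.2 ∉ A ∧ R e.1 e.2} ≤ d * #{w ∈ Aᶜ | ∃ v ∈ A, R v w} := by
  constructor
  · refine card_le_mul_card_image_of_maps_to (f := Prod.fst) ?_ d ?_
    · rintro ⟨u, v⟩ h
      simp only [mem_filter, mem_univ, true_and] at h ⊢
      exact ⟨h.1, v, h.2⟩
    · intro u _
      rw [← hdeg u]
      refine card_le_card_of_injOn Prod.snd ?_ ?_
      · rintro ⟨u', v⟩ h
        simp only [coe_filter, mem_filter, mem_univ, true_and, Set.mem_ofPred_eq] at h ⊢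
        exact h.2 ▸ h.1.2.2
      · rintro ⟨u₁, v₁⟩ h₁ ⟨u₂, v₂⟩ h₂ h
        simp only [coe_filter, mem_filter, mem_univ, true_and, Set.mem_ofPred_eq] at h₁ h₂ h
        rw [h₁.2, h₂.2, h]
  · refine card_le_mul_card_image_of_maps_to (f := Prod.snd) ?_ d ?_
    · rintro ⟨u, v⟩ h
      simp only [mem_filter, mem_univ, true_and, mem_compl] at h ⊢
      exact ⟨h.2.1, u, h.1, h.2.2⟩
    · intro u _
      rw [← hdeg u]
      refine card_le_card_of_injOn Prod.fst ?_ ?_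
      · rintro ⟨v, u'⟩ h
        simp only [coe_filter, mem_filter, mem_univ, true_and, Set.mem_ofPred_eq] at h ⊢
        exact h.2 ▸ hsymm _ _ h.1.2.2
      · rintro ⟨u₁, v₁⟩ h₁ ⟨u₂, v₂⟩ h₂ h
        simp only [coe_filter, mem_filter, mem_univ, true_and, Set.mem_ofPred_eq] at h₁ h₂ h
        rw [h₁.2, h₂.2, h]

theorem isBoundarySize_edgeBoundary
    (hadj : ∀ (g : Γ) u v, G.Adj (g • u) (g • v) ↔ G.Adj u v) :
    IsBoundarySize Γ G 1 fun A => (#(edgeBoundary G A Aᶜ) : ℝ) where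
  nonneg A := Nat.cast_nonneg _
  smul g A := by
    simp only [edgeBoundary_compl_eq, Nat.cast_inj]
    refine (card_equiv ((MulAction.toPerm g).prodCongr (MulAction.toPerm g)) fun e => ?_).symm
    simp [hadj]
  compl A := by
    simp only [edgeBoundary_compl_eq, Nat.cast_inj]
    refine card_equiv (Equiv.prodComm V V) fun e => ?_
    simp only [mem_filter, mem_univ, true_and, mem_compl, not_not, Equiv.prodComm_apply,
      Prod.fst_swap, Prod.snd_swap, G.adj_comm e.2 e.1]
    tauto
  inter_le A B := by
    simp only [edgeBoundary_compl_eq]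
    norm_cast
    refine (card_le_card ?_).trans (card_union_le _ _)
    intro e
    simp only [mem_filter, mem_univ, true_and, mem_inter, mem_union]
    tauto
  regular_le d R _ hd _ hR _ A := by
    simp only [edgeBoundary_compl_eq, one_mul]
    norm_cast
    refine (card_le_card ?_).trans (Nat.le_mul_of_pos_left _ hd)
    intro e
    simp only [mem_filter, mem_univ, true_and]
    exact fun h => ⟨h.1, h.2.1, hR _ _ h.2.2⟩

theorem isBoundarySize_vertexBoundary
    (hadj : ∀ (g : Γ) u v, G.Adj (g • u) (g • v) ↔ G.Adj u v) :
    IsBoundarySize Γ G 2 fun A => (#(vertexBoundary G A Aᶜ) : ℝ) where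
  nonneg A := Nat.cast_nonneg _
  smul g A := by
    simp only [vertexBoundary_compl_eq, Nat.cast_inj]
    refine (card_equiv (MulAction.toPerm g) fun v => ?_).symm
    simp only [mem_filter, mem_univ, true_and, MulAction.toPerm_apply]
    conv_rhs => rw [(MulAction.surjective g).exists]
    simp [hadj]
  compl A := by
    simp only [vertexBoundary_compl_eq, mem_compl, not_iff_not]
  inter_le A B := by
    simp only [vertexBoundary_compl_eq]
    norm_cast
    refine (card_le_card ?_).trans (card_union_le _ _)
    intro v
    simp only [mem_filter, mem_univ, true_and, mem_inter, mem_union]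
    rintro ⟨w, hvw, h⟩
    by_cases hA : v ∈ A ↔ w ∈ A
    · exact Or.inr ⟨w, hvw, by tauto⟩
    · exact Or.inl ⟨w, hvw, hA⟩
  regular_le d R _ _ hsymm hR hdeg A := by
    obtain ⟨h₁, h₂⟩ := card_crossing_le_mul_of_regular R hsymm hdeg A
    have h₃ : #{v ∈ A | ∃ w, w ∉ A ∧ R v w} + #{w ∈ Aᶜ | ∃ v ∈ A, R v w} ≤
        #(vertexBoundary G A Aᶜ) := by
      rw [← card_union_of_disjoint]
      · rw [vertexBoundary_compl_eq]
        refine card_le_card ?_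
        intro v
        simp only [mem_union, mem_filter, mem_univ, true_and, mem_compl]
        rintro (⟨h, w, hw, hvw⟩ | ⟨h, w, hw, hvw⟩)
        · exact ⟨w, hR _ _ hvw, fun h' => hw (h'.1 h)⟩
        · exact ⟨w, (hR _ _ hvw).symm, fun h' => h (h'.2 hw)⟩
      · exact disjoint_of_subset_left (filter_subset _ _)
          (disjoint_of_subset_right (filter_subset _ _) disjoint_compl_right)
    have h₄ := Nat.mul_le_mul_left d h₃
    rw [mul_add] at h₄
    have h₅ : 2 * #{e : V × V | e.1 ∈ A ∧ e.2 ∉ A ∧ R e.1 e.2} ≤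
        d * #(vertexBoundary G A Aᶜ) := by omega
    exact_mod_cast h₅

end BoundarySize

/-! ### From refinements to inequalities between isoperimetric constants. -/

section Comparison

variable {V : Type*} [Fintype V] [DecidableEq V] (G : SimpleGraph V) [DecidableRel G.Adj]

theorem iSup_div_card_le_iff {V : Type*} {n : ℕ} [NeZero n] {A : Fin n → Finset V} (hA : IsPartition A)
    (b : Finset V → ℝ) (r : ℝ) :
    ⨆ i, b (A i) / #(A i) ≤ r ↔ ∀ i, b (A i) ≤ r * #(A i) := by
  rw [ciSup_le_iff (Set.finite_range _).bddAbove]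
  refine forall_congr' fun i => div_le_iff₀ ?_
  exact_mod_cast (hA.nonempty i).card_pos

/-- Multiway isoperimetric constants of a boundary functional: the bound for `n + 1` parts in terms
of the minimum for `n` parts. -/
theorem IsBoundarySize.isLeast_le {Γ : Type*} [Group Γ] [Finite Γ] [MulAction Γ V]
    [MulAction.IsPretransitive Γ V] {G : SimpleGraph V} {k : ℝ} {b : Finset V → ℝ}
    (hb : IsBoundarySize Γ G k b) (hk : 0 < k) (hG : G.Connected)
    (hadj : ∀ (g : Γ) u v, G.Adj (g • u) (g • v) ↔ G.Adj u v) {n : ℕ} (hn : 2 ≤ n) {ε η : ℝ}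
    (hε : IsLeast {r : ℝ | ∃ A : Fin n → Finset V, IsPartition A ∧ r = ⨆ i, b (A i) / #(A i)} ε)
    (hη : IsLeast {r : ℝ | ∃ A : Fin (n + 1) → Finset V, IsPartition A ∧
      r = ⨆ i, b (A i) / #(A i)} η) :
    0 ≤ ε ∧ 0 ≤ η ∧ k * η / (10 * k * n + η) ≤ ε := by
  have : NeZero n := ⟨by omega⟩
  obtain ⟨A, hA, rfl⟩ := hε.1
  have hε0 : 0 ≤ ⨆ i, b (A i) / #(A i) :=
    Real.iSup_nonneg fun i => div_nonneg (hb.nonneg _) (Nat.cast_nonneg _)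
  have hη0 : 0 ≤ η := by
    obtain ⟨B, -, rfl⟩ := hη.1
    exact Real.iSup_nonneg fun i => div_nonneg (hb.nonneg _) (Nat.cast_nonneg _)
  refine ⟨hε0, hη0, ?_⟩
  have hA' := (iSup_div_card_le_iff hA b _).1 le_rfl
  set ε := ⨆ i, b (A i) / #(A i)
  have hn' : (2 : ℝ) ≤ n := by exact_mod_cast hn
  have hden : 0 < 10 * k * n + η := by positivity
  rw [div_le_iff₀ hden]
  -- For `ε ≥ k` no refinement is needed, since the left side is at most `k`.
  rcases le_or_gt k ε with hkε | hkε
  · have h1 : 0 ≤ 10 * k * n * ε := by positivity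
    nlinarith [mul_le_mul_of_nonneg_right hkε hη0]
  · obtain ⟨B, hB, hBε⟩ := hb.exists_refinement hk hG hadj hn hA hA' hkε
    have h1 : η ≤ 10 * n * ε / (1 - ε / k) :=
      (hη.2 ⟨B, hB, rfl⟩).trans ((iSup_div_card_le_iff hB b _).2 hBε)
    have hr : 0 < 1 - ε / k := by rw [sub_pos, div_lt_one hk]; exact hkε
    rw [le_div_iff₀ hr] at h1
    have h2 : k * (η * (1 - ε / k)) = k * η - η * ε := by field_simp
    have h3 := mul_le_mul_of_nonneg_left h1 hk.le
    linarith

theorem exists_isPartition_le_card {n : ℕ} (hn : 0 < n) (hV : n ≤ Fintype.card V) :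
    ∃ A : Fin n → Finset V, IsPartition A ∧ ∀ i, Fintype.card V / n ≤ #(A i) := by
  obtain ⟨P, hP, hcard⟩ := Finpartition.exists_equipartition_card_eq (univ : Finset V) hn.ne'
    (by simpa using hV)
  let e : Fin n ≃ P.parts := (Fintype.equivFinOfCardEq (by simpa using hcard)).symm
  refine ⟨fun i => (e i : Finset V), ⟨fun i => P.nonempty_of_mem_parts (e i).2,
    fun i j hij => P.disjoint (e i).2 (e j).2 fun h => hij (e.injective (Subtype.ext h)),
    fun v => ?_⟩, fun i => ?_⟩
  · obtain ⟨t, ht, hv⟩ := P.exists_mem (mem_univ v)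
    exact ⟨e.symm ⟨t, ht⟩, by simpa using hv⟩
  · have := hP.average_le_card_part (e i).2
    rwa [hcard, card_univ] at this

/-- An equipartition has parts of size at least the rounded-down quotient, and no boundary exceeds
`|V|`. -/
theorem iota_le_card_div {n : ℕ} (hn : 0 < n) (hV : n ≤ Fintype.card V) :
    iota G n ≤ Fintype.card V / (Fintype.card V / n : ℕ) := by
  have : NeZero n := ⟨hn.ne'⟩
  obtain ⟨A, hA, hcard⟩ := exists_isPartition_le_card hn hV
  refine ((iota_isLeast G hn hV).2 ⟨A, hA, rfl⟩).trans (ciSup_le fun i => ?_)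
  have h1 : 0 < Fintype.card V / n := Nat.div_pos hV hn
  exact div_le_div₀ (Nat.cast_nonneg _) (by exact_mod_cast card_le_univ _)
    (by exact_mod_cast h1) (by exact_mod_cast hcard i)

/-- A path leaving `A` has an edge that crosses out of `A`, and both its ends count. -/
theorem two_le_card_vertexBoundary (hG : G.Connected) {A : Finset V} (hA : A.Nonempty)
    (hA' : Aᶜ.Nonempty) : 2 ≤ #(vertexBoundary G A Aᶜ) := by
  obtain ⟨u, hu⟩ := hA
  obtain ⟨v, hv⟩ := hA'
  obtain ⟨q⟩ := hG.preconnected u v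
  obtain ⟨d, -, h1, h2⟩ := q.exists_boundary_dart (A : Set V) (by simpa using hu) (by simpa using hv)
  rw [vertexBoundary_compl_eq]
  rw [← card_pair d.adj.ne]
  refine card_le_card ?_
  intro w
  simp only [mem_coe] at h1 h2
  simp only [mem_insert, mem_singleton, mem_filter, mem_univ, true_and]
  rintro (rfl | rfl)
  · exact ⟨_, d.adj, by tauto⟩
  · exact ⟨_, d.adj.symm, by tauto⟩

/-- If the parts of a partition number more than a third of the vertices, then one of them has at
most two elements, hence a boundary at least as large as itself. -/
theorem one_le_iota (hG : G.Connected) {n : ℕ} (hn : 2 ≤ n) (hV : n ≤ Fintype.card V)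
    (hV' : Fintype.card V < 3 * n) : 1 ≤ iota G n := by
  obtain ⟨A, hA, hι⟩ := (iota_isLeast G (by omega) hV).1
  obtain ⟨i, hi⟩ : ∃ i, #(A i) < 3 := by
    by_contra! h
    have h1 : #(univ.biUnion A) = ∑ i, #(A i) :=
      card_biUnion fun i _ j _ hij => hA.disjoint i j hij
    have h2 : ∑ i : Fin n, 3 ≤ ∑ i, #(A i) := sum_le_sum fun i _ => h i
    have h3 := card_le_univ (univ.biUnion A)
    simp only [sum_const, card_univ, Fintype.card_fin, smul_eq_mul] at h2
    omega
  have : Nontrivial (Fin n) := Fin.nontrivial_iff_two_le.2 hn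
  obtain ⟨j, hj⟩ := exists_ne i
  obtain ⟨v, hv⟩ := hA.nonempty j
  have hb := two_le_card_vertexBoundary G hG (hA.nonempty i)
    ⟨v, mem_compl.2 fun h => disjoint_left.1 (hA.disjoint _ _ hj) hv h⟩
  have hpos := (hA.nonempty i).card_pos
  rw [hι]
  refine le_trans ?_ (le_ciSup (Set.finite_range _).bddAbove i)
  rw [one_le_div (by exact_mod_cast hpos)]
  exact_mod_cast (by omega : #(A i) ≤ #(vertexBoundary G (A i) (A i)ᶜ))

theorem iota_succ_le_mul (hG : G.Connected) {n : ℕ} (hn : 2 ≤ n) (hV : n + 1 ≤ Fintype.card V)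
    (h0 : 0 ≤ iota G n) (h0' : 0 ≤ iota G (n + 1))
    (h : 2 * iota G (n + 1) / (20 * n + iota G (n + 1)) ≤ iota G n) :
    iota G (n + 1) ≤ (11 * (n : ℝ) + 1) * iota G n := by
  have hn' : (2 : ℝ) ≤ n := by exact_mod_cast hn
  rw [div_le_iff₀ (by positivity)] at h
  -- Up to 2/11, `2 - ι_n ≥ 20/11` turns `h` into `ι_{n+1} ≤ 11 n ι_n`. Beyond it `11 n ι_n > 2n`,
  -- so `ι_{n+1} ≤ 2n` suffices.
  rcases le_or_gt (iota G n) (2 / 11) with hs | hs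
  · nlinarith
  have hle := iota_le_card_div G (Nat.succ_pos n) hV
  rcases le_or_gt (2 * (n + 1)) (Fintype.card V) with hN | hN
  · have hq : 2 ≤ Fintype.card V / (n + 1) := by
      rw [Nat.le_div_iff_mul_le (by omega)]
      exact hN
    have hlt : Fintype.card V < (n + 1) * (Fintype.card V / (n + 1) + 1) :=
      Nat.lt_mul_div_succ _ (Nat.succ_pos n)
    -- With `q` the quotient, `|V| ≤ n q + n + q`, and `n + q ≤ n q` because both are at least 2.
    have hmul : Fintype.card V ≤ 2 * n * (Fintype.card V / (n + 1)) := by nlinarith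
    have h2 : iota G (n + 1) ≤ 2 * n := by
      refine hle.trans ?_
      rw [div_le_iff₀ (by exact_mod_cast (by omega : 0 < Fintype.card V / (n + 1)))]
      exact_mod_cast hmul
    nlinarith
  -- Here `|V| ≤ 2n + 1 < 3n`, so `ι_n ≥ 1`, while `ι_{n+1} ≤ |V| ≤ 2n + 1`.
  · have h1 := one_le_iota G hG hn (by omega) (by omega)
    have hq : Fintype.card V / (n + 1) = 1 := by
      rw [Nat.div_eq_iff (Nat.succ_pos n)]
      omega
    rw [Nat.succ_eq_add_one, hq, Nat.cast_one, div_one] at hle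
    have h2 : (Fintype.card V : ℝ) ≤ 2 * n + 1 := by exact_mod_cast (by omega)
    nlinarith

end Comparison

end MultiwayIsoperimetry

theorem theorem1p1 {V : Type*} [Fintype V] [DecidableEq V]
    (G : SimpleGraph V) [DecidableRel G.Adj]
    (hconn : G.Connected) (htrans : MultiwayIsoperimetry.IsVertexTransitive G)
    (n : ℕ) (hn : 2 ≤ n) (hnV : n ≤ Fintype.card V - 1) :
    MultiwayIsoperimetry.h G n ≥
        MultiwayIsoperimetry.h G (n + 1) / (10 * (n : ℝ) + MultiwayIsoperimetry.h G (n + 1)) ∧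
      MultiwayIsoperimetry.iota G n ≥
        2 * MultiwayIsoperimetry.iota G (n + 1) /
          (20 * (n : ℝ) + MultiwayIsoperimetry.iota G (n + 1)) ∧
      MultiwayIsoperimetry.iota G (n + 1) ≤
        (11 * (n : ℝ) + 1) * MultiwayIsoperimetry.iota G n := by
  have hV : n + 1 ≤ Fintype.card V := by omega
  have : Finite (G ≃g G) := DFunLike.finite _
  have : MulAction.IsPretransitive (G ≃g G) V := ⟨htrans⟩
  have hadj : ∀ (g : G ≃g G) u v, G.Adj (g • u) (g • v) ↔ G.Adj u v := fun g u v => g.map_rel_iff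
  have hh := (MultiwayIsoperimetry.isBoundarySize_edgeBoundary G hadj).isLeast_le one_pos hconn
    hadj hn (MultiwayIsoperimetry.h_isLeast G (by omega) (by omega))
    (MultiwayIsoperimetry.h_isLeast G (by omega) hV)
  have hι := (MultiwayIsoperimetry.isBoundarySize_vertexBoundary G hadj).isLeast_le two_pos hconn
    hadj hn (MultiwayIsoperimetry.iota_isLeast G (by omega) (by omega))
    (MultiwayIsoperimetry.iota_isLeast G (by omega) hV)
  have hι₂ : 2 * MultiwayIsoperimetry.iota G (n + 1) /
      (20 * (n : ℝ) + MultiwayIsoperimetry.iota G (n + 1)) ≤ MultiwayIsoperimetry.iota G n := by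
    convert hι.2.2 using 3
    norm_num
  refine ⟨?_, hι₂, MultiwayIsoperimetry.iota_succ_le_mul G hconn hn hV hι.1 hι.2.1 hι₂⟩
  simpa using hh.2.2
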